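/- Let $n,r$ be integers with $3\le r\le n-1$, let $X_n=\{1<\dots<n\}$, and let maps act on the right, so that $\alpha\beta$ means first $\alpha$, then $\beta$. For $\alpha:X_n\to X_n$ put $(n+1)\alpha=1\alpha$. Call $\alpha$ orientation-preserving (orientation-reversing) if at most one $i\in X_n$ satisfies $(i+1)\alpha<i\alpha$ (respectively $i\alpha<(i+1)\alpha$), oriented if it is one or the other, and order-decreasing if $a\alpha\le a$ for all $a\in X_n$. Let $\mathcal{ORD}_n$ be the semigroup of all oriented order-decreasing maps $X_n\to X_n$, let $\mathcal{OPD}_n$ be the set of all orientation-preserving order-decreasing maps $X_n\to X_n$, and let $\mathcal{ORD}(n,r)=\{\alpha\in\mathcal{ORD}_n : |\mathrm{im}(\alpha)|\le r\}$. For $\alpha\in\mathcal{OPD}_n$ let $\mathrm{opd}(\alpha)$ be the largest $m\le n$ such that $\alpha$ is order-preserving on $\{1,\dots,m\}$. For $r+1\le m\le n$ let $B_m$ be the set of idempotents $\alpha\in\mathcal{OPD}_n$ with $|\mathrm{im}(\alpha)|=r$ and $\mathrm{opd}(\alpha)=m$. For $2\le m\le r$ let $\rho_m$ be the map with $x\rho_m=x$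 for $x\le m$ and $x\rho_m=1$ for $x>m$. Put $C=\bigcup_{m=r+1}^{n}B_m\cup\{\rho_2,\dots,\rho_r\}$. Let $\hat r=\min\{r,\lceil (n+1)/2\rceil\}$. For $3\le m\le n-1$ define $\lambda_{m,\hat r}:X_n\to X_n$ as follows. If $m\le n-\hat r+1$, put $p=\max\{0,m-\hat r\}$ and let $x\lambda_{m,\hat r}=2m-x$ for $m\le x\le 2m-p-2$ and $x\lambda_{m,\hat r}=1$ for all other $x$. If $m\ge n-\hat r+2$, let $x\lambda_{m,\hat r}=1$ for $x\le m-1$ and $x\lambda_{m,\hat r}=2m-x$ for $m\le x\le n$. Let $$L_{m,\hat r}=\{\alpha\in\mathcal{ORD}_n : \mathrm{im}(\alpha)=\mathrm{im}(\lambda_{m,\hat r})\text{ and }\min(x\alpha^{-1})=\min(x\lambda_{m,\hat r}^{-1})\text{ for all }x\in\mathrm{im}(\lambda_{m,\hat r})\}.$$ Theorem. Let $S$ be a subsemigroup of $\mathcal{ORD}(n,r)$. Then $S$ is a maximal subsemigroup of $\mathcal{ORD}(n,r)$ (that is, $S\ne\mathcal{ORD}(n,r)$ and no subsemigroup lies strictly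 between $S$ and $\mathcal{ORD}(n,r)$) if and only if one of the following holds: - $S=\mathcal{ORD}(n,r)\setminus\{\alpha\}$ for some $\alpha\in C$; - $S=\mathcal{ORD}(n,r)\setminus\{\lambda_{m,\hat r}\}$ for some $m$ with $n-\hat r+2\le m\le n-1$; - $S=\mathcal{ORD}(n,r)\setminus L_{m,\hat r}$ for some $m$ with $3\le m\le n-\hat r+1$. -/

import Mathlib

namespace OrdTrans

/-- The chain `X_n = {1 < ⋯ < n}`. -/
abbrev X (n : ℕ) : Type := Set.Icc (1 : ℕ) n

/-- The set of full transformations of `X_n`. -/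
def T (n : ℕ) : Type := X n → X n

instance (n : ℕ) : CoeFun (T n) (fun _ => X n → X n) := ⟨fun α => α⟩

/-- Maps act on the right: `α * β` is "first `α`, then `β`". -/
instance (n : ℕ) : Semigroup (T n) where
  mul α β := fun x => β (α x)
  mul_assoc _ _ _ := rfl

theorem mul_apply {n : ℕ} (α β : T n) (x : X n) : (α * β) x = β (α x) := rfl

@[ext] theorem T.ext {n : ℕ} {α β : T n} (h : ∀ x, α x = β x) : α = β := funext h

/-- The cyclic successor on `X_n`: `i ↦ i + 1` for `i < n`, and `n ↦ 1`. -/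
def next {n : ℕ} (i : X n) : X n :=
  if h : (i : ℕ) < n then ⟨i + 1, Nat.le_add_left 1 i, h⟩
  else ⟨1, le_refl 1, i.2.1.trans i.2.2⟩

/-- `(1α, …, nα)` is cyclic: at most one `i` satisfies `(i+1)α < iα`, where `(n+1)α = 1α`. -/
def OrientationPreserving {n : ℕ} (α : T n) : Prop :=
  {i : X n | α (next i) < α i}.Subsingleton

/-- `(1α, …, nα)` is anti-cyclic: at most one `i` satisfies `iα < (i+1)α`,
where `(n+1)α = 1α`. -/
def OrientationReversing {n : ℕ} (α : T n) : Prop :=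
  {i : X n | α i < α (next i)}.Subsingleton

def Oriented {n : ℕ} (α : T n) : Prop :=
  OrientationPreserving α ∨ OrientationReversing α

def OrderDecreasing {n : ℕ} (α : T n) : Prop := ∀ a : X n, α a ≤ a

/-- The size of the image of `α`. -/
noncomputable def rk {n : ℕ} (α : T n) : ℕ := (Set.range α).ncard

/-! ### Closure of the oriented order-decreasing maps under products

A decreasing map fixes `1`, which gives convenient descriptions of the oriented ones. -/

theorem next_val {n : ℕ} (i : X n) : (next i : ℕ) = if (i : ℕ) < n then (i : ℕ) + 1 else 1 := by
  unfold next; split_ifs <;> rfl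

theorem exists_descent {n : ℕ} (α : T n) (d : ℕ) :
    ∀ i j : X n, (j : ℕ) = i + d → α j < α i →
      ∃ k : X n, i ≤ k ∧ k < j ∧ α (next k) < α k := by
  induction d with
  | zero =>
    intro i j h hlt
    have : j = i := Subtype.ext (by simpa using h)
    subst this; exact absurd hlt (lt_irrefl _)
  | succ d ih =>
    intro i j h hlt
    have hjn := j.2.2
    have hi : (i : ℕ) < n := by omega
    have hv : (next i : ℕ) = i + 1 := by rw [next_val, if_pos hi]
    by_cases hd : α (next i) < α i
    · exact ⟨i, le_rfl, by rw [← Subtype.coe_lt_coe]; omega, hd⟩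
    · obtain ⟨k, h1, h2, h3⟩ := ih (next i) j (by omega) (lt_of_lt_of_le hlt (not_lt.1 hd))
      refine ⟨k, ?_, h2, h3⟩
      rw [← Subtype.coe_le_coe] at h1 ⊢; omega

theorem exists_ascent {n : ℕ} (α : T n) (d : ℕ) :
    ∀ i j : X n, (j : ℕ) = i + d → α i < α j →
      ∃ k : X n, i ≤ k ∧ k < j ∧ α k < α (next k) := by
  induction d with
  | zero =>
    intro i j h hlt
    have : j = i := Subtype.ext (by simpa using h)
    subst this; exact absurd hlt (lt_irrefl _)
  | succ d ih =>
    intro i j h hlt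
    have hjn := j.2.2
    have hi : (i : ℕ) < n := by omega
    have hv : (next i : ℕ) = i + 1 := by rw [next_val, if_pos hi]
    by_cases hd : α i < α (next i)
    · exact ⟨i, le_rfl, by rw [← Subtype.coe_lt_coe]; omega, hd⟩
    · obtain ⟨k, h1, h2, h3⟩ := ih (next i) j (by omega) (lt_of_le_of_lt (not_lt.1 hd) hlt)
      refine ⟨k, ?_, h2, h3⟩
      rw [← Subtype.coe_le_coe] at h1 ⊢; omega

theorem OrderDecreasing.val_one {n : ℕ} {α : T n} (hα : OrderDecreasing α) (i : X n)
    (hi : (i : ℕ) = 1) : (α i : ℕ) = 1 := by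
  have h1 : (α i : ℕ) ≤ i := hα i
  have h2 := (α i).2.1
  omega

theorem orientationPreserving_iff {n : ℕ} {α : T n} (hα : OrderDecreasing α) :
    OrientationPreserving α ↔ ∀ i j k : X n, i < j → j ≤ k → α i ≤ α j ∨ (α k : ℕ) = 1 := by
  constructor
  · intro h i j k hij hjk
    by_contra hc
    push Not at hc
    obtain ⟨h1, h2⟩ := hc
    have hk1 := (α k).2.1
    have hi1 := i.2.1
    have hin := i.2.2
    obtain ⟨a, ha1, ha2, ha3⟩ := exists_descent α ((j : ℕ) - i) i j
      (by have : (i : ℕ) < j := hij; omega) h1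
    have hl : ∃ b : X n, k ≤ b ∧ α (next b) < α b := by
      let l : X n := ⟨n, by omega, le_rfl⟩
      have hlast : (α (next l) : ℕ) = 1 := hα.val_one _ (by
        rw [next_val, if_neg (by show ¬ n < n; omega)])
      by_cases hkl : α l < α k
      · obtain ⟨b, hb1, hb2, hb3⟩ := exists_descent α (n - k) k l
          (by have := k.2.2; show n = _; omega) hkl
        exact ⟨b, hb1, hb3⟩
      · refine ⟨l, k.2.2, ?_⟩
        rw [not_lt, ← Subtype.coe_le_coe] at hkl
        rw [← Subtype.coe_lt_coe]; omega
    obtain ⟨b, hb1, hb2⟩ := hl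
    have hab : a = b := h ha3 hb2
    subst hab
    exact absurd (lt_of_lt_of_le ha2 hjk) (not_lt.2 hb1)
  · intro h
    have key : ∀ a b : X n, α (next a) < α a → α (next b) < α b → a < b → False := by
      intro a b ha hb hab
      have hab' : (a : ℕ) < b := hab
      have hbn := b.2.2
      have hv : (next a : ℕ) = a + 1 := by rw [next_val, if_pos (by omega)]
      rcases h a (next a) b (by rw [← Subtype.coe_lt_coe]; omega)
        (by rw [← Subtype.coe_le_coe]; omega) with h' | h'
      · exact absurd ha (not_lt.2 h')
      · have := (α (next b)).2.1
        rw [← Subtype.coe_lt_coe] at hb; omega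
    intro a ha b hb
    rcases lt_trichotomy a b with hab | hab | hab
    · exact (key a b ha hb hab).elim
    · exact hab
    · exact (key b a hb ha hab).elim

theorem orientationReversing_iff {n : ℕ} {α : T n} (hα : OrderDecreasing α) :
    OrientationReversing α ↔ ∀ i j k : X n, i ≤ j → j < k → α k ≤ α j ∨ (α i : ℕ) = 1 := by
  constructor
  · intro h i j k hij hjk
    by_contra hc
    push Not at hc
    obtain ⟨h1, h2⟩ := hc
    have hk1 := (α i).2.1
    have hi1 := i.2.1
    have hin := i.2.2
    obtain ⟨a, ha1, ha2, ha3⟩ := exists_ascent α ((k : ℕ) - j) j k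
      (by have : (j : ℕ) < k := hjk; omega) h1
    let l : X n := ⟨1, le_rfl, by omega⟩
    have hl : (α l : ℕ) = 1 := hα.val_one _ rfl
    obtain ⟨b, hb1, hb2, hb3⟩ := exists_ascent α ((i : ℕ) - 1) l i
      (by show (i : ℕ) = 1 + (i - 1); omega) (by rw [← Subtype.coe_lt_coe]; omega)
    have hab : a = b := h ha3 hb3
    subst hab
    exact absurd (lt_of_lt_of_le hb2 hij) (not_lt.2 ha1)
  · intro h
    have key : ∀ a b : X n, α a < α (next a) → α b < α (next b) → a < b → False := by
      intro a b ha hb hab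
      have hab' : (a : ℕ) < b := hab
      have hbn := b.2.2
      have hv : (next a : ℕ) = a + 1 := by rw [next_val, if_pos (by omega)]
      by_cases hbl : (b : ℕ) < n
      · have hw : (next b : ℕ) = b + 1 := by rw [next_val, if_pos hbl]
        rcases h (next a) b (next b) (by rw [← Subtype.coe_le_coe]; omega)
          (by rw [← Subtype.coe_lt_coe]; omega) with h' | h'
        · exact absurd hb (not_lt.2 h')
        · have := (α a).2.1
          rw [← Subtype.coe_lt_coe] at ha; omega
      · have hw : (α (next b) : ℕ) = 1 := hα.val_one _ (by rw [next_val, if_neg hbl])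
        have := (α b).2.1
        rw [← Subtype.coe_lt_coe] at hb; omega
    intro a ha b hb
    rcases lt_trichotomy a b with hab | hab | hab
    · exact (key a b ha hb hab).elim
    · exact hab
    · exact (key b a hb ha hab).elim

theorem OrderDecreasing.mul {n : ℕ} {α β : T n} (hα : OrderDecreasing α)
    (hβ : OrderDecreasing β) : OrderDecreasing (α * β) :=
  fun a => (hβ (α a)).trans (hα a)

theorem Oriented.mul {n : ℕ} {α β : T n} (hα : OrderDecreasing α) (hβ : OrderDecreasing β)
    (h1 : Oriented α) (h2 : Oriented β) : Oriented (α * β) := by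
  have hαβ := hα.mul hβ
  unfold Oriented at *
  rw [orientationPreserving_iff hαβ, orientationReversing_iff hαβ]
  rw [orientationPreserving_iff hα, orientationReversing_iff hα] at h1
  rw [orientationPreserving_iff hβ, orientationReversing_iff hβ] at h2
  simp only [mul_apply]
  rcases h1 with h1 | h1 <;> rcases h2 with h2 | h2
  · left
    intro i j k hij hjk
    rcases h1 i j k hij hjk with h | h
    · rcases h.eq_or_lt with e | l
      · left; rw [e]
      · rcases hjk.eq_or_lt with e | l'
        · subst e; exact h2 _ _ _ l le_rfl
        · rcases h1 j k k l' le_rfl with h' | h'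
          · exact h2 _ _ _ l h'
          · right; exact hβ.val_one _ h'
    · right; exact hβ.val_one _ h
  · right
    intro i j k hij hjk
    rcases h1 j k k hjk le_rfl with h | h
    · rcases h.eq_or_lt with e | l
      · left; rw [e]
      · rcases hij.eq_or_lt with e | l'
        · subst e; exact h2 _ _ _ le_rfl l
        · rcases h1 i j k l' hjk.le with h' | h'
          · exact h2 _ _ _ h' l
          · left
            have : (β (α k) : ℕ) = 1 := hβ.val_one _ h'
            rw [← Subtype.coe_le_coe, this]; exact (β (α j)).2.1
    · left
      have : (β (α k) : ℕ) = 1 := hβ.val_one _ h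
      rw [← Subtype.coe_le_coe, this]; exact (β (α j)).2.1
  · right
    intro i j k hij hjk
    rcases h1 i j k hij hjk with h | h
    · rcases h.eq_or_lt with e | l
      · left; rw [e]
      · rcases hij.eq_or_lt with e | l'
        · subst e; exact h2 _ _ _ l le_rfl
        · rcases h1 i i j le_rfl l' with h' | h'
          · exact h2 _ _ _ l h'
          · right; exact hβ.val_one _ h'
    · right; exact hβ.val_one _ h
  · left
    intro i j k hij hjk
    rcases h1 i i j le_rfl hij with h | h
    · rcases h.eq_or_lt with e | l
      · left; rw [e]
      · rcases hjk.eq_or_lt with e | l'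
        · subst e; exact h2 _ _ _ le_rfl l
        · rcases h1 i j k hij.le l' with h' | h'
          · exact h2 _ _ _ h' l
          · left
            have : (β (α i) : ℕ) = 1 := hβ.val_one _ h'
            rw [← Subtype.coe_le_coe, this]; exact (β (α j)).2.1
    · left
      have : (β (α i) : ℕ) = 1 := hβ.val_one _ h
      rw [← Subtype.coe_le_coe, this]; exact (β (α j)).2.1

/-! ### The semigroups `ORD(n,r)` and their distinguished elements -/

/-- `ORD_n`: the oriented order-decreasing full transformations of `X_n`. -/
def ORDfull (n : ℕ) : Subsemigroup (T n) where
  carrier := {α | Oriented α ∧ OrderDecreasing α}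
  mul_mem' h1 h2 := ⟨h1.1.mul h1.2 h2.2 h2.1, h1.2.mul h2.2⟩

theorem rk_mul_le {n : ℕ} (α β : T n) : rk (α * β) ≤ rk α := by
  have h : Set.range (α * β) = β '' Set.range α := Set.range_comp β α
  unfold rk
  rw [h]
  exact Set.ncard_image_le (Set.toFinite _)

/-- `ORD(n,r)`: the elements of `ORD_n` whose image has at most `r` elements. -/
def ORD (n r : ℕ) : Subsemigroup (T n) where
  carrier := {α | α ∈ ORDfull n ∧ rk α ≤ r}
  mul_mem' h1 h2 := ⟨mul_mem h1.1 h2.1, (rk_mul_le _ _).trans h1.2⟩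

/-- `OPD_n`: the orientation-preserving order-decreasing full transformations of `X_n`. -/
def OPDfull (n : ℕ) : Set (T n) := {α | OrientationPreserving α ∧ OrderDecreasing α}

/-- The order-preserving degree of `α`: the largest `m ≤ n` such that `α` is order-preserving
on `{1, …, m}`. (The set below contains `0` and is bounded by `n`.) -/
noncomputable def opd {n : ℕ} (α : T n) : ℕ :=
  sSup {m : ℕ | m ≤ n ∧ ∀ a b : X n, a < b → (b : ℕ) ≤ m → α a ≤ α b}

/-- `B_m`: the idempotents of `OPD_n` with image of size `r` and order-preserving degree `m`. -/
def B (n r m : ℕ) : Set (T n) :=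
  {α | α ∈ OPDfull n ∧ IsIdempotentElem α ∧ rk α = r ∧ opd α = m}

/-- The transformation `x ↦ f x` of `X_n`, for `f : ℕ → ℕ` mapping `{1, …, n}` to itself.
(Arguments whose value falls outside `{1, …, n}` are fixed; this never happens below.) -/
def ofVal (n : ℕ) (f : ℕ → ℕ) : T n :=
  fun x => if h : f x ∈ Set.Icc 1 n then ⟨f x, h⟩ else x

theorem ofVal_val {n : ℕ} {f : ℕ → ℕ} (x : X n) (h : f x ∈ Set.Icc 1 n) :
    (ofVal n f x : ℕ) = f x := by
  unfold ofVal; rw [dif_pos h]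

/-- `ρ_m`: fixes `1, …, m` and sends `m + 1, …, n` to `1`. -/
def rho (n m : ℕ) : T n := ofVal n fun x => if x ≤ m then x else 1

/-- The set `C`: the union of the `B_m` for `r + 1 ≤ m ≤ n`, together with `ρ_2, …, ρ_r`. -/
def C (n r : ℕ) : Set (T n) :=
  {α | ∃ m, r + 1 ≤ m ∧ m ≤ n ∧ α ∈ B n r m} ∪ {α | ∃ m, 2 ≤ m ∧ m ≤ r ∧ α = rho n m}

/-- `r̂`: equal to `r` if `r ≤ ⌈(n+1)/2⌉`, and to `⌈(n+1)/2⌉` otherwise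
(`⌈/⌉` is division rounded up). -/
def hat (n r : ℕ) : ℕ := if r ≤ (n + 1) ⌈/⌉ 2 then r else (n + 1) ⌈/⌉ 2

/-- The values of `λ_{m,r}`. Here `p = max {0, m - r}` is truncated subtraction.
If `m ≤ n - r + 1`, then `[1, m-1] ↦ 1`, `m + i ↦ m - i` for `m ≤ m + i ≤ 2m - p - 2`, and
`[2m-p-1, n] ↦ 1`. Otherwise `[1, m-1] ↦ 1` and `m + i ↦ m - i` for `m ≤ m + i ≤ n`. -/
def lamVal (n r m x : ℕ) : ℕ :=
  if m ≤ n - r + 1 then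
    let p := m - r
    if x ≤ m - 1 then 1 else if x ≤ 2 * m - p - 2 then 2 * m - x else 1
  else
    if x ≤ m - 1 then 1 else 2 * m - x

/-- `λ_{m,r}`, for `3 ≤ r ≤ ⌈(n+1)/2⌉` and `3 ≤ m ≤ n - 1`. -/
def lam (n r m : ℕ) : T n := ofVal n (lamVal n r m)

/-- In the intended range of parameters `λ_{m,r}` has the values prescribed by `lamVal`. -/
theorem lam_val {n r m : ℕ} (hr : r ≤ (n + 1) ⌈/⌉ 2) (hm : 3 ≤ m) (hmn : m ≤ n - 1)
    (x : X n) : (lam n r m x : ℕ) = lamVal n r m x := by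
  apply ofVal_val
  have h1 := x.2.1
  have h2 := x.2.2
  rw [Nat.ceilDiv_eq_add_pred_div] at hr
  simp only [lamVal, Set.mem_Icc]
  split_ifs <;> omega

/-- `L_{m,r}`: the elements of `ORD_n` with the same image as `λ_{m,r}` and with
`min (xα⁻¹) = min (xλ_{m,r}⁻¹)` for every `x` in that image. -/
def L (n r m : ℕ) : Set (T n) :=
  {α | α ∈ ORDfull n ∧ Set.range α = Set.range (lam n r m) ∧
    ∀ x ∈ Set.range (lam n r m), ∀ a : X n,
      IsLeast (α ⁻¹' {x}) a ↔ IsLeast (lam n r m ⁻¹' {x}) a}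

/-- `S` is a maximal subsemigroup of `M`: it is properly contained in `M`, and there is no
subsemigroup strictly between `S` and `M`. -/
def IsMaximalSubsemigroup {A : Type*} [Mul A] (S M : Subsemigroup A) : Prop :=
  S < M ∧ ∀ U : Subsemigroup A, S ≤ U → U < M → U = S

end OrdTrans

/-! The maximal subsemigroups are the complements of the unavoidable pieces of a generating set. Two
facts are needed about a piece `D` of `M = ORD n r`. If a product in `M` lies in `D` only when a
factor does, then `M \ D` is a subsemigroup. If every element of `D` is obtained from any other by
left multiplication by an element of `M \ D` (trivially so for a singleton), then `M \ D` is
maximal.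

The pieces are the singletons `{α}` with `α ∈ C n r` and the sets `K n r m` for `3 ≤ m ≤ n - 1`,
whose elements follow the reflection `x ↦ 2m - x` on a window starting at `m`. Irreducibility is
`irreducible_of_mem_C` and `mem_K_of_mul_mem_K`; transitivity inside `K n r m` is
`exists_mul_eq_of_mem_K`. Both rest on `(xβ)γ ≤ xβ ≤ x`: an extremal value of a product determines
its factors.

Conversely, `C n r` together with one element of each `K n r m` generates `M`
(`ORD_le_of_generators`). So a maximal `S` misses some piece entirely, lies in its complement, and
equals it. Finally `K n r m` is identified with `L n (hat n r) m`, and with `{lam n (hat n r) m}`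
when the window reaches `n`. -/

namespace OrdTrans

/-! ### Basic constructions -/

/-- The decreasing map with prescribed natural number values. -/
def ofFun {n : ℕ} (f : X n → ℕ) (h : ∀ x, 1 ≤ f x ∧ f x ≤ x) : T n :=
  fun x => ⟨f x, (h x).1, (h x).2.trans x.2.2⟩

theorem ofFun_val {n : ℕ} (f : X n → ℕ) (h : ∀ x, 1 ≤ f x ∧ f x ≤ x) (x : X n) :
    (ofFun f h x : ℕ) = f x := rfl

theorem ofFun_decreasing {n : ℕ} (f : X n → ℕ) (h : ∀ x, 1 ≤ f x ∧ f x ≤ x) :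
    OrderDecreasing (ofFun f h) := fun x => (h x).2

theorem T.ext_val {n : ℕ} {α β : T n} (h : ∀ x, (α x : ℕ) = β x) : α = β :=
  T.ext fun x => Subtype.ext (h x)

theorem mul_val {n : ℕ} {α β γ : T n} (h : β * γ = α) (x : X n) : (γ (β x) : ℕ) = α x :=
  congrArg (fun e : T n => (e x : ℕ)) h

theorem one_le_val {n : ℕ} (x : X n) : 1 ≤ (x : ℕ) := x.2.1

theorem val_le {n : ℕ} (x : X n) : (x : ℕ) ≤ n := x.2.2

theorem OrderDecreasing.val {n : ℕ} {α : T n} (h : OrderDecreasing α) (x : X n) :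
    (α x : ℕ) ≤ x := h x

/-- In words: a decreasing map preserves orientation when it is monotone up to the last position
with value other than `1`. Dually, it reverses orientation when it is antitone from the first such
position on. Stating this in `ℕ` suits `omega`. -/
theorem orientationPreserving_iff_val {n : ℕ} {α : T n} (hα : OrderDecreasing α) :
    OrientationPreserving α ↔ ∀ i j k : X n, (i : ℕ) < j → (j : ℕ) ≤ k →
      (α i : ℕ) ≤ α j ∨ (α k : ℕ) = 1 :=
  orientationPreserving_iff hα

theorem orientationReversing_iff_val {n : ℕ} {α : T n} (hα : OrderDecreasing α) :
    OrientationReversing α ↔ ∀ i j k : X n, (i : ℕ) ≤ j → (j : ℕ) < k →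
      (α k : ℕ) ≤ α j ∨ (α i : ℕ) = 1 :=
  orientationReversing_iff hα

/-- The image of a transformation as a finite set of natural numbers. -/
def im {n : ℕ} (α : T n) : Finset ℕ := Finset.univ.image fun x => (α x : ℕ)

theorem mem_im {n : ℕ} {α : T n} {v : ℕ} : v ∈ im α ↔ ∃ x, (α x : ℕ) = v := by
  simp [im]

theorem apply_mem_im {n : ℕ} (α : T n) (x : X n) : (α x : ℕ) ∈ im α := mem_im.2 ⟨x, rfl⟩

theorem rk_eq_card_im {n : ℕ} (α : T n) : rk α = (im α).card := by
  have h : ((im α : Finset ℕ) : Set ℕ) = Subtype.val '' Set.range α := by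
    ext v
    rw [Finset.mem_coe, mem_im]
    constructor
    · rintro ⟨x, rfl⟩
      exact ⟨_, ⟨x, rfl⟩, rfl⟩
    · rintro ⟨_, ⟨x, rfl⟩, rfl⟩
      exact ⟨x, rfl⟩
  rw [← Set.ncard_coe_finset, h, Set.ncard_image_of_injective _ Subtype.val_injective]
  rfl

theorem im_subset_Icc {n : ℕ} (α : T n) : im α ⊆ Finset.Icc 1 n := by
  intro v hv
  obtain ⟨x, rfl⟩ := mem_im.1 hv
  exact Finset.mem_Icc.2 (α x).2

theorem OrderDecreasing.one_mem_im {n : ℕ} {α : T n} (h : OrderDecreasing α) (hn : 1 ≤ n) :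
    1 ∈ im α :=
  mem_im.2 ⟨⟨1, le_rfl, hn⟩, h.val_one _ rfl⟩

/-! ### Order-preserving retractions -/

/-- For `x ≤ m` send `x` to the largest element of `A ∪ {1}` below `x`; send `x > m` to `1`. -/
def retract (n : ℕ) (A : Finset ℕ) (m : ℕ) : T n :=
  ofFun (fun x => if (x : ℕ) ≤ m then Nat.findGreatest (fun i => i = 1 ∨ i ∈ A) x else 1)
    fun x => by
      have hx := one_le_val x
      split_ifs
      · exact ⟨Nat.le_findGreatest hx (Or.inl rfl), Nat.findGreatest_le _⟩
      · exact ⟨le_rfl, hx⟩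

section retract

variable {n m : ℕ} {A : Finset ℕ}

theorem retract_decreasing : OrderDecreasing (retract n A m) := ofFun_decreasing _ _

theorem retract_of_lt (x : X n) (h : m < x) : (retract n A m x : ℕ) = 1 := by
  simp only [retract, ofFun_val]
  rw [if_neg (by omega)]

theorem retract_mem (h1 : 1 ∈ A) (x : X n) : (retract n A m x : ℕ) ∈ A := by
  simp only [retract, ofFun_val]
  split_ifs
  · have := Nat.findGreatest_spec (P := fun i => i = 1 ∨ i ∈ A) (one_le_val x) (Or.inl rfl)
    rcases this with h | h
    · rw [h]; exact h1
    · exact h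
  · exact h1

theorem le_retract (x : X n) (hx : (x : ℕ) ≤ m) {a : ℕ} (ha : a ∈ A) (hax : a ≤ x) :
    a ≤ retract n A m x := by
  simp only [retract, ofFun_val]
  rw [if_pos hx]
  exact Nat.le_findGreatest hax (Or.inr ha)

theorem retract_eq (h1 : 1 ∈ A) (x : X n) (hx : (x : ℕ) ≤ m) {a : ℕ} (ha : a ∈ A) (hax : a ≤ x)
    (h : ∀ b ∈ A, b ≤ x → b ≤ a) : (retract n A m x : ℕ) = a :=
  le_antisymm (h _ (retract_mem h1 x) (retract_decreasing x)) (le_retract x hx ha hax)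

theorem retract_fix (h1 : 1 ∈ A) (x : X n) (hx : (x : ℕ) ≤ m) (ha : (x : ℕ) ∈ A) :
    (retract n A m x : ℕ) = x :=
  retract_eq h1 x hx ha le_rfl fun _ _ h => h

theorem retract_mono (h1 : 1 ∈ A) {i j : X n} (hij : (i : ℕ) ≤ j) (hj : (j : ℕ) ≤ m) :
    (retract n A m i : ℕ) ≤ retract n A m j :=
  le_retract j hj (retract_mem h1 i) ((retract_decreasing.val i).trans hij)

theorem retract_orientationPreserving (h1 : 1 ∈ A) : OrientationPreserving (retract n A m) := by
  rw [orientationPreserving_iff_val retract_decreasing]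
  intro i j k hij hjk
  by_cases hk : (k : ℕ) ≤ m
  · exact Or.inl (retract_mono h1 hij.le (hjk.trans hk))
  · exact Or.inr (retract_of_lt k (not_le.1 hk))

theorem im_retract (h1 : 1 ∈ A) (hA : A ⊆ Finset.Icc 1 m) (hm : m ≤ n) :
    im (retract n A m) = A := by
  ext v
  rw [mem_im]
  constructor
  · rintro ⟨x, rfl⟩
    exact retract_mem h1 x
  · intro hv
    have := Finset.mem_Icc.1 (hA hv)
    exact ⟨⟨v, this.1, this.2.trans hm⟩, retract_fix h1 _ this.2 hv⟩

theorem retract_idempotent (h1 : 1 ∈ A) (hA : A ⊆ Finset.Icc 1 m) :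
    IsIdempotentElem (retract n A m) :=
  T.ext_val fun x =>
    retract_fix h1 _ (Finset.mem_Icc.1 (hA (retract_mem h1 x))).2 (retract_mem h1 x)

theorem opd_retract (h1 : 1 ∈ A) (hA : A ⊆ Finset.Icc 1 m) (hm : m ≤ n) (hc : 2 ≤ A.card) :
    opd (retract n A m) = m := by
  apply IsGreatest.csSup_eq
  refine ⟨⟨hm, fun a b hab hb => retract_mono h1 (le_of_lt hab) hb⟩, ?_⟩
  rintro k ⟨hk, hmono⟩
  by_contra! hmk
  -- A fixed point `a > 1` together with `m + 1 ↦ 1` breaks monotonicity just past `m`.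
  obtain ⟨a, ha, ha1⟩ := Finset.exists_mem_ne (by omega : 1 < A.card) 1
  have ham := Finset.mem_Icc.1 (hA ha)
  have h2 := hmono ⟨a, ham.1, ham.2.trans hm⟩ ⟨m + 1, by omega, by omega⟩
    (by rw [← Subtype.coe_lt_coe]; show a < m + 1; omega) hmk
  rw [← Subtype.coe_le_coe, retract_fix h1 _ ham.2 ha, retract_of_lt _ (Nat.lt_succ_self m)] at h2
  have h3 : a ≤ 1 := h2
  omega

theorem retract_mem_C {r : ℕ} (h1 : 1 ∈ A) (hA : A ⊆ Finset.Icc 1 m) (hm : m ≤ n)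
    (hr : 2 ≤ r) (hc : A.card = r) (hrm : r + 1 ≤ m) : retract n A m ∈ C n r :=
  Or.inl ⟨m, hrm, hm, ⟨retract_orientationPreserving h1, retract_decreasing⟩,
    retract_idempotent h1 hA, by rw [rk_eq_card_im, im_retract h1 hA hm, hc],
    opd_retract h1 hA hm (by omega)⟩

end retract

/-! ### The maps `ρ_m` and the set `C` -/

theorem rho_val {n m : ℕ} (x : X n) : (rho n m x : ℕ) = if (x : ℕ) ≤ m then (x : ℕ) else 1 := by
  apply ofVal_val
  have := x.2
  simp only [Set.mem_Icc] at *
  split_ifs <;> omega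

theorem rho_decreasing {n m : ℕ} : OrderDecreasing (rho n m) := by
  intro x
  rw [← Subtype.coe_le_coe, rho_val]
  have := one_le_val x
  split_ifs <;> omega

theorem rho_orientationPreserving {n m : ℕ} : OrientationPreserving (rho n m) := by
  rw [orientationPreserving_iff_val rho_decreasing]
  intro i j k _ _
  simp only [rho_val]
  split_ifs <;> omega

theorem rk_rho_le {n m : ℕ} (hm : 1 ≤ m) : rk (rho n m) ≤ m := by
  rw [rk_eq_card_im]
  have h : im (rho n m) ⊆ Finset.Icc 1 m := by
    intro v hv
    obtain ⟨x, rfl⟩ := mem_im.1 hv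
    rw [rho_val, Finset.mem_Icc]
    have := one_le_val x
    split_ifs <;> omega
  simpa using Finset.card_le_card h

theorem C_subset_ORD {n r : ℕ} {α : T n} (h : α ∈ C n r) : α ∈ ORD n r := by
  rcases h with ⟨m, _, _, h1, _, h3, _⟩ | ⟨m, hm, hmr, rfl⟩
  · exact ⟨⟨Or.inl h1.1, h1.2⟩, h3.le⟩
  · exact ⟨⟨Or.inl rho_orientationPreserving, rho_decreasing⟩,
      (rk_rho_le (by omega)).trans hmr⟩

/-! ### Irreducibility of the elements of `C` -/

/-- Equal ranks make `γ` injective on the image of `β`, so idempotency of `βγ` gives `(xβγ)β = xβ`.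
As `β` and `γ` are decreasing, `xβ ≤ xβγ ≤ xβ`. -/
theorem eq_left_of_idempotent_mul {n : ℕ} {β γ : T n} (hβ : OrderDecreasing β)
    (hγ : OrderDecreasing γ) (hid : IsIdempotentElem (β * γ)) (hrk : rk β ≤ rk (β * γ)) :
    β = β * γ := by
  have hinj : Set.InjOn γ (Set.range β) := by
    apply Set.injOn_of_ncard_image_eq _ (Set.toFinite _)
    have h : γ '' Set.range β = Set.range (β * γ) := (Set.range_comp γ β).symm
    rw [h]
    exact le_antisymm (rk_mul_le β γ) hrk
  apply T.ext_val
  intro x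
  have h1 : (β * γ) ((β * γ) x) = (β * γ) x := congrArg (fun e : T n => e x) hid
  have h2 : β ((β * γ) x) = β x := hinj ⟨_, rfl⟩ ⟨_, rfl⟩ h1
  have h3 := hβ.val ((β * γ) x)
  rw [h2] at h3
  exact le_antisymm h3 (hγ.val (β x))

theorem fixes_of_mul_eq_rho {n m : ℕ} {β γ : T n} (hβ : OrderDecreasing β)
    (hγ : OrderDecreasing γ) (h : β * γ = rho n m) (x : X n) (hx : (x : ℕ) ≤ m) :
    β x = x ∧ γ x = x := by
  have h1 : (γ (β x) : ℕ) = x := by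
    have h0 := mul_val h x
    rwa [rho_val, if_pos hx] at h0
  have h2 : β x = x := le_antisymm (hβ x) (by
    rw [← Subtype.coe_le_coe, ← h1]; exact hγ (β x))
  refine ⟨h2, Subtype.ext ?_⟩
  rw [h2] at h1
  exact h1

/-- If `β` preserves orientation, the descent from `m` to `m + 1` forces the value `1` from then on.
If it reverses orientation, it is antitone from the fixed point `2` on, so it stays at `1` after `m
+ 1`. -/
theorem eq_rho_of_fixes {n m : ℕ} {β : T n} (hm : 2 ≤ m) (hmn : m < n) (hβ : OrderDecreasing β)
    (ho : Oriented β) (hfix : ∀ x : X n, (x : ℕ) ≤ m → β x = x)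
    (h1 : (β ⟨m + 1, by omega, hmn⟩ : ℕ) = 1) : β = rho n m := by
  apply T.ext_val
  intro x
  rw [rho_val]
  split_ifs with hx
  · rw [hfix x hx]
  · rcases ho with ho | ho
    · rw [orientationPreserving_iff_val hβ] at ho
      have hxn := val_le x
      let y : X n := ⟨m, by omega, by omega⟩
      have hy : (β y : ℕ) = m := congrArg Subtype.val (hfix y le_rfl)
      rcases ho y ⟨m + 1, by omega, hmn⟩ x (Nat.lt_succ_self m) (not_le.1 hx) with h | h
      · omega
      · exact h
    · rw [orientationReversing_iff_val hβ] at ho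
      let y : X n := ⟨2, by omega, by omega⟩
      have hy : (β y : ℕ) = 2 := congrArg Subtype.val (hfix y hm)
      let z : X n := ⟨m + 1, by omega, hmn⟩
      have hz : (β z : ℕ) = 1 := h1
      have hb := one_le_val (β x)
      by_cases hxz : (x : ℕ) = m + 1
      · have : x = z := Subtype.ext hxz
        rw [this, hz]
      · rcases ho y z x (by show 2 ≤ m + 1; omega) (by show m + 1 < (x : ℕ); omega) with h | h
          <;> omega

/-- Both factors fix `1, …, m`, so everything depends on where `β` sends `m + 1`. An image at most
`m` is fixed by `γ`, hence is `1`; otherwise `β` fixes `m + 1` and `γ` sends it to `1`. -/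
theorem eq_rho_of_mul_eq_rho {n m : ℕ} {β γ : T n} (hm : 2 ≤ m) (hmn : m < n)
    (hβ : OrderDecreasing β) (hγ : OrderDecreasing γ) (hβo : Oriented β) (hγo : Oriented γ)
    (h : β * γ = rho n m) : β = rho n m ∨ γ = rho n m := by
  have hfix := fixes_of_mul_eq_rho hβ hγ h
  let z : X n := ⟨m + 1, by omega, hmn⟩
  have hz : (γ (β z) : ℕ) = 1 := by
    have h0 := mul_val h z
    rwa [rho_val, if_neg (by show ¬ m + 1 ≤ m; omega)] at h0
  by_cases hβz : (β z : ℕ) ≤ m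
  · left
    apply eq_rho_of_fixes hm hmn hβ hβo fun x hx => (hfix x hx).1
    rw [(hfix _ hβz).2] at hz
    exact hz
  · right
    apply eq_rho_of_fixes hm hmn hγ hγo fun x hx => (hfix x hx).2
    have h1 : β z = z := by
      have := hβ.val z
      have hzv : (z : ℕ) = m + 1 := rfl
      exact Subtype.ext (by omega)
    rw [h1] at hz
    exact hz

theorem irreducible_of_mem_C {n r : ℕ} (hrn : r ≤ n - 1) (hr : 3 ≤ r) {β γ : T n}
    (hβ : β ∈ ORD n r) (hγ : γ ∈ ORD n r) (h : β * γ ∈ C n r) : β = β * γ ∨ γ = β * γ := by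
  rcases h with ⟨m, _, _, _, h2, h3, _⟩ | ⟨m, hm, hmr, h⟩
  · left
    exact eq_left_of_idempotent_mul hβ.1.2 hγ.1.2 h2 (h3 ▸ hβ.2)
  · rw [h]
    exact eq_rho_of_mul_eq_rho hm (by omega) hβ.1.2 hγ.1.2 hβ.1.1 hγ.1.1 h

/-! ### Orientation-reversing maps starting like `λ_m` -/

/-- The orientation-reversing maps in `ORD(n,r)` with `x ↦ 2m - x` for
`m ≤ x ≤ min (m + r - 2) (2m - 2)`. -/
def K (n r m : ℕ) : Set (T n) :=
  {α | α ∈ ORD n r ∧ OrientationReversing α ∧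
    ∀ x : X n, m ≤ (x : ℕ) → (x : ℕ) + 2 ≤ m + r → (x : ℕ) + 2 ≤ 2 * m → (α x : ℕ) + x = 2 * m}

theorem rk_le_of_val_eq {n : ℕ} {α β : T n} (g : ℕ → ℕ) (h : ∀ x, (β x : ℕ) = g (α x)) :
    rk β ≤ rk α := by
  rw [rk_eq_card_im, rk_eq_card_im]
  have h' : im β ⊆ (im α).image g := by
    intro v hv
    obtain ⟨x, rfl⟩ := mem_im.1 hv
    rw [h]
    exact Finset.mem_image_of_mem _ (apply_mem_im α x)
  exact (Finset.card_le_card h').trans Finset.card_image_le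

section K

variable {n r m : ℕ}

theorem not_orientationPreserving_of_swap {α : T n} (hα : OrderDecreasing α) (hm : 3 ≤ m)
    {x y : X n} (hx : (x : ℕ) = m) (hy : (y : ℕ) = m + 1) (hαx : (α x : ℕ) = m)
    (hαy : (α y : ℕ) = m - 1) : ¬ OrientationPreserving α := by
  rw [orientationPreserving_iff_val hα]
  intro h
  rcases h x y y (by omega) le_rfl with h | h <;> omega

theorem not_orientationPreserving_of_mem_K (hr : 3 ≤ r) (hm : 3 ≤ m) (hmn : m ≤ n - 1)
    {α : T n} (h : α ∈ K n r m) : ¬ OrientationPreserving α := by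
  let x : X n := ⟨m, by omega, by omega⟩
  let y : X n := ⟨m + 1, by omega, by omega⟩
  have hx : (x : ℕ) = m := rfl
  have hy : (y : ℕ) = m + 1 := rfl
  have h1 := h.2.2 x (by omega) (by omega) (by omega)
  have h2 := h.2.2 y (by omega) (by omega) (by omega)
  exact not_orientationPreserving_of_swap h.1.1.2 hm hx hy (by omega) (by omega)

/-- Both factors fix `m`, and `β` is injective on the window because the product is. An
orientation-preserving `β` must then climb by steps of one, so it is the identity there and `γ` does
the reflecting. An orientation-reversing `β` strictly descends, yet stays above the product, which
descends by steps of one; so `β` agrees with it on the window. -/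
theorem mem_K_of_mul_mem_K (hr : 3 ≤ r) (hm : 3 ≤ m) (hmn : m ≤ n - 1) {β γ : T n}
    (hβ : β ∈ ORD n r) (hγ : γ ∈ ORD n r) (h : β * γ ∈ K n r m) : β ∈ K n r m ∨ γ ∈ K n r m := by
  obtain ⟨-, -, hval⟩ := h
  have hval : ∀ x : X n, m ≤ (x : ℕ) → (x : ℕ) + 2 ≤ m + r → (x : ℕ) + 2 ≤ 2 * m →
    (γ (β x) : ℕ) + x = 2 * m := hval
  let z : X n := ⟨m, by omega, by omega⟩
  have hz : (z : ℕ) = m := rfl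
  have hγz := hval z (by omega) (by omega) (by omega)
  have hβz : β z = z := by
    have h1 := hβ.1.2.val z
    have h2 := hγ.1.2.val (β z)
    exact Subtype.ext (by omega)
  rw [hβz] at hγz
  rcases hβ.1.1 with ho | ho
  · right
    have hfix : ∀ d : ℕ, ∀ x : X n, (x : ℕ) = m + d → (x : ℕ) + 2 ≤ m + r →
        (x : ℕ) + 2 ≤ 2 * m → β x = x := by
      intro d
      induction d with
      | zero =>
        intro x hx _ _
        have : x = z := Subtype.ext hx
        rw [this, hβz]
      | succ d ih =>
        intro x hx hxr hxm
        let y : X n := ⟨m + d, by omega, by have := val_le x; omega⟩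
        have hy : (y : ℕ) = m + d := rfl
        have hβy := ih y hy (by omega) (by omega)
        have h1 := hval x (by omega) hxr hxm
        have h2 := hval y (by omega) (by omega) (by omega)
        have h3 := hβ.1.2.val x
        have h4 := hγ.1.2.val (β x)
        rw [orientationPreserving_iff_val hβ.1.2] at ho
        have h5 : β x ≠ β y := by
          intro he
          rw [he] at h1
          omega
        have h6 : (β x : ℕ) ≠ β y := fun he => h5 (Subtype.ext he)
        rw [hβy] at h6
        apply Subtype.ext
        rcases ho y x x (by omega) le_rfl with h | h
        · rw [hβy] at h
          omega
        · omega
    have hγval : ∀ x : X n, m ≤ (x : ℕ) → (x : ℕ) + 2 ≤ m + r → (x : ℕ) + 2 ≤ 2 * m →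
        (γ x : ℕ) + x = 2 * m := by
      intro x h1 h2 h3
      have := hval x h1 h2 h3
      rwa [hfix (x - m) x (by omega) h2 h3] at this
    refine ⟨hγ, ?_, hγval⟩
    rcases hγ.1.1 with hγo | hγo
    · let y : X n := ⟨m + 1, by omega, by omega⟩
      have hy : (y : ℕ) = m + 1 := rfl
      have hγy := hγval y (by omega) (by omega) (by omega)
      exact absurd hγo
        (not_orientationPreserving_of_swap hγ.1.2 hm hz hy (by omega) (by omega))
    · exact hγo
  · left
    refine ⟨hβ, ho, ?_⟩
    have key : ∀ d : ℕ, ∀ x : X n, (x : ℕ) = m + d → (x : ℕ) + 2 ≤ m + r →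
        (x : ℕ) + 2 ≤ 2 * m → (β x : ℕ) + x = 2 * m := by
      intro d
      induction d with
      | zero =>
        intro x hx _ _
        have : x = z := Subtype.ext hx
        rw [this, hβz]
        omega
      | succ d ih =>
        intro x hx hxr hxm
        let y : X n := ⟨m + d, by omega, by have := val_le x; omega⟩
        have hy : (y : ℕ) = m + d := rfl
        have hβy := ih y hy (by omega) (by omega)
        have h1 := hval x (by omega) hxr hxm
        have h2 := hval y (by omega) (by omega) (by omega)
        have h4 := hγ.1.2.val (β x)
        rw [orientationReversing_iff_val hβ.1.2] at ho
        have h5 : β x ≠ β y := by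
          intro he
          rw [he] at h1
          omega
        have h6 : (β x : ℕ) ≠ β y := fun he => h5 (Subtype.ext he)
        rcases ho y y x le_rfl (by omega) with h | h <;> omega
    exact fun x h1 h2 h3 => key (x - m) x (by omega) h2 h3

/-- Since `κ` reflects `x ↦ 2m - x` on its window, the left factor is `α` followed by the same
reflection, with `1` kept at `1`. The absence of gaps below `m` makes this factor decreasing and
keeps its values other than `1` in the window. -/
theorem exists_orientationPreserving_mul_eq (hm : 3 ≤ m) {α κ : T n} (hα : α ∈ ORD n r)
    (hrev : OrientationReversing α) (hκ : κ ∈ K n r m) (hmax : ∀ x, (α x : ℕ) ≤ m)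
    (hcons : ∀ x, 2 ≤ (α x : ℕ) → (α x : ℕ) < m → ∃ y, (α y : ℕ) = α x + 1) :
    ∃ β ∈ ORD n r, OrientationPreserving β ∧ α = β * κ := by
  have hd := hα.1.2
  rw [orientationReversing_iff_val hd] at hrev
  -- Going down from `m`: the value `m` occurs no earlier than position `m`, and each smaller value
  -- occurs strictly after the next larger one.
  have hle : ∀ d : ℕ, ∀ x, (α x : ℕ) + d = m → 2 ≤ (α x : ℕ) →
      2 * m ≤ α x + x ∧ ∀ v, (α x : ℕ) ≤ v → v ≤ m → v ∈ im α := by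
    intro d
    induction d with
    | zero =>
      intro x hx _
      refine ⟨by have := hd.val x; omega, fun v h1 h2 => ?_⟩
      have : v = α x := by omega
      rw [this]
      exact apply_mem_im α x
    | succ d ih =>
      intro x hx h2
      obtain ⟨y, hy⟩ := hcons x h2 (by omega)
      obtain ⟨h3, h4⟩ := ih y (by omega) (by omega)
      constructor
      · have hne : (x : ℕ) ≠ y := by
          intro h
          rw [Subtype.ext h] at hy
          omega
        have : ¬ (x : ℕ) < y := by
          intro h
          rcases hrev x x y le_rfl h with h | h <;> omega
        omega
      · intro v h5 h6
        rcases h5.eq_or_lt with h | h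
        · rw [← h]
          exact apply_mem_im α x
        · exact h4 v (by omega) h6
  have hbound : ∀ x, 2 ≤ (α x : ℕ) → 2 * m ≤ α x + x ∧ m + 2 ≤ α x + r := by
    intro x hx
    obtain ⟨h1, h2⟩ := hle (m - α x) x (by have := hmax x; omega) hx
    refine ⟨h1, ?_⟩
    -- Counting these values against the rank bound `r` gives the upper end `m + r - 2` of the
    -- window.
    have hsub : insert 1 (Finset.Icc (α x : ℕ) m) ⊆ im α := by
      intro v hv
      rcases Finset.mem_insert.1 hv with rfl | hv
      · exact hd.one_mem_im ((one_le_val x).trans (val_le x))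
      · exact h2 v (Finset.mem_Icc.1 hv).1 (Finset.mem_Icc.1 hv).2
    have hcard := (Finset.card_le_card hsub).trans (rk_eq_card_im α ▸ hα.2)
    rw [Finset.card_insert_of_notMem (by rw [Finset.mem_Icc]; omega), Nat.card_Icc] at hcard
    have := hmax x
    omega
  have hf : ∀ x : X n, 1 ≤ (if (α x : ℕ) = 1 then 1 else 2 * m - α x) ∧
      (if (α x : ℕ) = 1 then 1 else 2 * m - α x) ≤ (x : ℕ) := by
    intro x
    have h1 := one_le_val (α x)
    have h2 := hmax x
    have h3 := one_le_val x
    split_ifs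
    · omega
    · have := hbound x (by omega)
      omega
  let β : T n := ofFun (fun x => if (α x : ℕ) = 1 then 1 else 2 * m - α x) hf
  have hβval : ∀ x, (β x : ℕ) = if (α x : ℕ) = 1 then 1 else 2 * m - α x := fun x => rfl
  have hβd : OrderDecreasing β := ofFun_decreasing _ hf
  have hβo : OrientationPreserving β := by
    rw [orientationPreserving_iff_val hβd]
    intro i j k hij hjk
    rw [hβval, hβval, hβval]
    have hi := one_le_val (α i)
    have hj := hmax j
    have hk := one_le_val (α k)
    by_cases hk1 : (α k : ℕ) = 1
    · simp [hk1]
    · left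
      by_cases hi1 : (α i : ℕ) = 1
      · rw [if_pos hi1]
        split_ifs <;> omega
      · have h1 : (α k : ℕ) ≤ α j := by
          rcases hjk.eq_or_lt with h | h
          · rw [Subtype.ext h]
          · rcases hrev i j k hij.le h with h | h
            · exact h
            · exact absurd h hi1
        have h2 : (α j : ℕ) ≤ α i := by
          rcases hrev i i j le_rfl hij with h | h
          · exact h
          · exact absurd h hi1
        rw [if_neg hi1, if_neg (by omega)]
        omega
  refine ⟨β, ⟨⟨Or.inl hβo, hβd⟩,
    (rk_le_of_val_eq (fun v => if v = 1 then 1 else 2 * m - v) hβval).trans hα.2⟩, hβo, ?_⟩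
  apply T.ext_val
  intro x
  show (α x : ℕ) = κ (β x)
  by_cases h1 : (α x : ℕ) = 1
  · rw [h1, hκ.1.1.2.val_one _ (by rw [hβval, if_pos h1])]
  · have h2 := hβval x
    rw [if_neg h1] at h2
    have h3 := one_le_val (α x)
    have h4 := hmax x
    have h5 := hbound x (by omega)
    have h6 := hκ.2.2 (β x) (by omega) (by omega) (by omega)
    omega

/-- The window determines the image and the first occurrence of every value. Before `m` a value
other than `1` would precede the larger value `m`; after the window a new value would either lie
below `2` or make the rank exceed `r`. -/
theorem eq_one_or_exists_of_mem_K (hm : 3 ≤ m) (hmn : m ≤ n - 1) (hr : 3 ≤ r) {α : T n}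
    (hα : α ∈ K n r m) (x : X n) :
    (α x : ℕ) = 1 ∨ ∃ y : X n, m ≤ (y : ℕ) ∧ (y : ℕ) ≤ x ∧ (y : ℕ) + 2 ≤ m + r ∧
      (y : ℕ) + 2 ≤ 2 * m ∧ (α y : ℕ) = α x := by
  have hd := hα.1.1.2
  have hrev := hα.2.1
  have hval := hα.2.2
  rw [orientationReversing_iff_val hd] at hrev
  let z : X n := ⟨m, by omega, by omega⟩
  have hz : (z : ℕ) = m := rfl
  have hαz := hval z (by omega) (by omega) (by omega)
  by_cases hxm : (x : ℕ) < m
  · left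
    have h1 := hd.val x
    rcases hrev x x z le_rfl (by omega) with h | h <;> omega
  by_cases hxt : (x : ℕ) + 2 ≤ m + r ∧ (x : ℕ) + 2 ≤ 2 * m
  · exact Or.inr ⟨x, not_lt.1 hxm, le_rfl, hxt.1, hxt.2, rfl⟩
  by_cases hx1 : (α x : ℕ) = 1
  · exact Or.inl hx1
  right
  have hxn := val_le x
  -- The last point of the window. If it is `2m - 2`, its value is already `2`; if it is `m + r -
  -- 2`, the window and the value `1` use up all `r` values.
  let t : X n := ⟨min (m + r - 2) (2 * m - 2), by omega, by omega⟩
  have ht : (t : ℕ) = min (m + r - 2) (2 * m - 2) := rfl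
  have hαt := hval t (by omega) (by omega) (by omega)
  have hle : (α x : ℕ) ≤ α t := by
    rcases hrev t t x le_rfl (by omega) with h | h <;> omega
  have hx0 := one_le_val (α x)
  refine ⟨t, by omega, by omega, by omega, by omega, ?_⟩
  by_contra hne
  have hsub : insert 1 (insert (α x : ℕ) (Finset.Icc (2 * m - t) m)) ⊆ im α := by
    intro v hv
    rcases Finset.mem_insert.1 hv with rfl | hv
    · exact hd.one_mem_im (by omega)
    rcases Finset.mem_insert.1 hv with rfl | hv
    · exact apply_mem_im α x
    · have hv := Finset.mem_Icc.1 hv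
      let y : X n := ⟨2 * m - v, by omega, by omega⟩
      have hy : (y : ℕ) = 2 * m - v := rfl
      have := hval y (by omega) (by omega) (by omega)
      exact mem_im.2 ⟨y, by omega⟩
  have hcard := (Finset.card_le_card hsub).trans (rk_eq_card_im α ▸ hα.1.2)
  rw [Finset.card_insert_of_notMem, Finset.card_insert_of_notMem, Nat.card_Icc] at hcard
  · omega
  · rw [Finset.mem_Icc]
    omega
  · rw [Finset.mem_insert, Finset.mem_Icc]
    omega

theorem exists_mul_eq_of_mem_K (hm : 3 ≤ m) (hmn : m ≤ n - 1) (hr : 3 ≤ r) {α κ : T n}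
    (hα : α ∈ K n r m) (hκ : κ ∈ K n r m) :
    ∃ β ∈ ORD n r, OrientationPreserving β ∧ α = β * κ := by
  refine exists_orientationPreserving_mul_eq hm hα.1 hα.2.1 hκ (fun x => ?_) fun x h2 hlt => ?_
  · rcases eq_one_or_exists_of_mem_K hm hmn hr hα x with h | ⟨y, h1, -, h3, h4, h5⟩
    · omega
    · have := hα.2.2 y h1 h3 h4
      omega
  · rcases eq_one_or_exists_of_mem_K hm hmn hr hα x with h | ⟨y, h1, -, h3, h4, h5⟩
    · omega
    · have h6 := hα.2.2 y h1 h3 h4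
      have := val_le y
      let w : X n := ⟨y - 1, by omega, by omega⟩
      have hw : (w : ℕ) = y - 1 := rfl
      have := hα.2.2 w (by omega) (by omega) (by omega)
      exact ⟨w, by omega⟩

/-! ### Invariants shared by all elements of `K`: image and least preimages -/

theorem range_subset_of_mem_K (hm : 3 ≤ m) (hmn : m ≤ n - 1) (hr : 3 ≤ r) {α κ : T n}
    (hα : α ∈ K n r m) (hκ : κ ∈ K n r m) : Set.range α ⊆ Set.range κ := by
  rintro _ ⟨x, rfl⟩
  rcases eq_one_or_exists_of_mem_K hm hmn hr hα x with h | ⟨y, h1, -, h3, h4, h5⟩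
  · refine ⟨⟨1, le_rfl, by omega⟩, Subtype.ext ?_⟩
    rw [hκ.1.1.2.val_one _ rfl, h]
  · refine ⟨y, Subtype.ext ?_⟩
    have h6 := hα.2.2 y h1 h3 h4
    have h7 := hκ.2.2 y h1 h3 h4
    omega

theorem isLeast_of_mem_K (hm : 3 ≤ m) (hmn : m ≤ n - 1) (hr : 3 ≤ r) {α κ : T n}
    (hα : α ∈ K n r m) (hκ : κ ∈ K n r m) {v a : X n} (h : IsLeast (α ⁻¹' {v}) a) :
    IsLeast (κ ⁻¹' {v}) a := by
  obtain ⟨rfl, hmin⟩ := h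
  have hdα := hα.1.1.2
  have hdκ := hκ.1.1.2
  rcases eq_one_or_exists_of_mem_K hm hmn hr hα a with h1 | ⟨y, h1, h2, h3, h4, h5⟩
  · have ha : (a : ℕ) = 1 := by
      have h3 : (a : ℕ) ≤ 1 := hmin (a := ⟨1, le_rfl, by omega⟩)
        (Subtype.ext ((hdα.val_one _ rfl).trans h1.symm))
      have := one_le_val a
      omega
    refine ⟨Subtype.ext ((hdκ.val_one a ha).trans h1.symm), fun b _ => ?_⟩
    rw [← Subtype.coe_le_coe, ha]
    exact one_le_val b
  · have h6 : (a : ℕ) ≤ y := hmin (a := y) (Subtype.ext h5)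
    have hya : y = a := Subtype.ext (by omega)
    subst hya
    have h7 := hα.2.2 y h1 h3 h4
    have h8 := hκ.2.2 y h1 h3 h4
    refine ⟨Subtype.ext (by omega), fun b hb => ?_⟩
    have hb : (κ b : ℕ) = α y := congrArg Subtype.val hb
    rw [← Subtype.coe_le_coe]
    rcases eq_one_or_exists_of_mem_K hm hmn hr hκ b with h9 | ⟨z, g1, g2, g3, g4, g5⟩
    · omega
    · have g6 := hκ.2.2 z g1 g3 g4
      omega

end K

/-! ### Generation -/

section generation

variable {n r : ℕ} {S : Subsemigroup (T n)}

/-- The first factor may stop too early, at `c`; the second then carries `c` down into `A`, because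
the extra point `d` lies above it. -/
theorem retract_mul_retract {A : Finset ℕ} (h1 : 1 ∈ A) {c d : ℕ} (hcd : c < d) (hd : d ∉ A) :
    retract n A n = retract n (insert c A) n * retract n (insert d A) n := by
  have hc1 : 1 ∈ insert c A := Finset.mem_insert_of_mem h1
  have hd1 : 1 ∈ insert d A := Finset.mem_insert_of_mem h1
  apply T.ext_val
  intro x
  show (retract n A n x : ℕ) = retract n (insert d A) n (retract n (insert c A) n x)
  have ha := retract_mem (n := n) (m := n) h1 x
  have hay := le_retract (A := insert c A) x (val_le x) (Finset.mem_insert_of_mem ha)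
    (retract_decreasing.val x)
  symm
  refine retract_eq hd1 _ (val_le _) (Finset.mem_insert_of_mem ha) hay fun b hb hby => ?_
  have hbx : ∀ b ∈ A, b ≤ (retract n (insert c A) n x : ℕ) → b ≤ (retract n A n x : ℕ) :=
    fun b hb h => le_retract x (val_le x) hb (h.trans (retract_decreasing.val x))
  rcases Finset.mem_insert.1 hb with rfl | hb
  · rcases Finset.mem_insert.1 (retract_mem (n := n) (m := n) hc1 x) with h | h
    · omega
    · exact hby.trans (hbx _ h le_rfl)
  · exact hbx b hb hby

theorem retract_mem_of_C (hr : 3 ≤ r) (hrn : r ≤ n - 1) (hC : ∀ α ∈ C n r, α ∈ S) (d : ℕ) :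
    ∀ A : Finset ℕ, 1 ∈ A → A ⊆ Finset.Icc 1 n → A.card + d = r → retract n A n ∈ S := by
  induction d with
  | zero =>
    intro A h1 hA hc
    exact hC _ (retract_mem_C h1 hA le_rfl (by omega) hc (by omega))
  | succ d ih =>
    intro A h1 hA hc
    -- Here `|A| < r ≤ n - 1`, so two points are available to enlarge `A`.
    have hcard : 1 < (Finset.Icc 1 n \ A).card := by
      rw [Finset.card_sdiff_of_subset hA, Nat.card_Icc]
      omega
    have key : ∀ c e : ℕ, c ∈ Finset.Icc 1 n \ A → e ∈ Finset.Icc 1 n \ A → c < e →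
        retract n A n ∈ S := by
      intro c e hc' he hce
      rw [Finset.mem_sdiff] at hc' he
      rw [retract_mul_retract h1 hce he.2]
      apply S.mul_mem
      · exact ih _ (Finset.mem_insert_of_mem h1) (Finset.insert_subset hc'.1 hA)
          (by rw [Finset.card_insert_of_notMem hc'.2]; omega)
      · exact ih _ (Finset.mem_insert_of_mem h1) (Finset.insert_subset he.1 hA)
          (by rw [Finset.card_insert_of_notMem he.2]; omega)
    obtain ⟨c, hc', e, he, hne⟩ := Finset.one_lt_card.1 hcard
    rcases lt_or_gt_of_ne hne with h | h
    · exact key c e hc' he h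
    · exact key e c he hc' h

/-- If a property of decreasing maps is stable under raising a value by one, then it suffices to
generate the maps with this property in which no value can be raised. -/
theorem mem_of_unraisable
    (hS : ∀ A : Finset ℕ, 1 ∈ A → A ⊆ Finset.Icc 1 n → A.card ≤ r → retract n A n ∈ S)
    (Q : T n → Prop) (hQo : ∀ α, OrderDecreasing α → Q α → Oriented α)
    (hQ : ∀ (α β : T n) (v : ℕ), OrderDecreasing α → OrderDecreasing β → 2 ≤ v →
      (∀ x, (α x : ℕ) ≠ v + 1) → (∀ x, (β x : ℕ) = if (α x : ℕ) = v then v + 1 else α x) →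
      Q α → Q β)
    (h : ∀ α ∈ ORD n r, Q α → (∀ x, (∀ y, (α y : ℕ) = α x → (α x : ℕ) + 1 ≤ y) →
      ∃ y, (α y : ℕ) = α x + 1) → α ∈ S) :
    ∀ α ∈ ORD n r, Q α → α ∈ S := by
  have main : ∀ d : ℕ, ∀ α ∈ ORD n r, Q α → ∑ x, (n - (α x : ℕ)) = d → α ∈ S := by
    intro d
    induction d using Nat.strong_induction_on with
    | _ d ih =>
      intro α hα hQα hsum
      by_cases hraise : ∀ x, (∀ y, (α y : ℕ) = α x → (α x : ℕ) + 1 ≤ y) →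
          ∃ y, (α y : ℕ) = α x + 1
      · exact h α hα hQα hraise
      · push Not at hraise
        obtain ⟨x, hx, hne⟩ := hraise
        have hd := hα.1.2
        have hn : 1 ≤ n := (one_le_val x).trans (val_le x)
        have hv : 2 ≤ (α x : ℕ) := by
          by_contra! hlt
          have h1 := one_le_val (α x)
          have h2 := hx ⟨1, le_rfl, hn⟩ (by rw [hd.val_one _ rfl]; omega)
          have h3 : (α x : ℕ) + 1 ≤ 1 := h2
          omega
        have hf : ∀ y : X n, 1 ≤ (if (α y : ℕ) = α x then (α x : ℕ) + 1 else α y) ∧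
            (if (α y : ℕ) = α x then (α x : ℕ) + 1 else α y) ≤ (y : ℕ) := by
          intro y
          split_ifs with hy
          · exact ⟨by omega, hx y hy⟩
          · exact ⟨one_le_val _, hd.val y⟩
        let β : T n := ofFun (fun y => if (α y : ℕ) = α x then (α x : ℕ) + 1 else α y) hf
        have hβval : ∀ y, (β y : ℕ) = if (α y : ℕ) = α x then (α x : ℕ) + 1 else α y :=
          fun y => rfl
        have hβd : OrderDecreasing β := ofFun_decreasing _ hf
        have hQβ := hQ α β (α x) hd hβd hv hne hβval hQα
        have hβM : β ∈ ORD n r :=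
          ⟨⟨hQo β hβd hQβ, hβd⟩,
            (rk_le_of_val_eq (fun v => if v = α x then (α x : ℕ) + 1 else v) hβval).trans hα.2⟩
        have h1 := hd.one_mem_im hn
        -- The raised value is not in the image of `α`, so retracting onto that image lowers it back
        -- by one. The induction is on the total distance of the values from `n`.
        have heq : α = β * retract n (im α) n := by
          apply T.ext_val
          intro y
          show (α y : ℕ) = retract n (im α) n (β y)
          have hβy := hβval y
          split_ifs at hβy with hy
          · symm
            refine retract_eq h1 _ (val_le _) (apply_mem_im α y) (by omega) fun b hb hle => ?_
            obtain ⟨z, rfl⟩ := mem_im.1 hb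
            have := hne z
            omega
          · rw [retract_fix h1 _ (val_le _) (by rw [hβy]; exact apply_mem_im α y), hβy]
        rw [heq]
        refine S.mul_mem (ih _ ?_ β hβM hQβ rfl)
          (hS _ h1 (im_subset_Icc α) (rk_eq_card_im α ▸ hα.2))
        rw [← hsum]
        apply Finset.sum_lt_sum
        · intro y _
          have hβy := hβval y
          split_ifs at hβy <;> omega
        · refine ⟨x, Finset.mem_univ x, ?_⟩
          have hβx := hβval x
          rw [if_pos rfl] at hβx
          have := val_le (β x)
          omega
  exact fun α hα hQα => main _ α hα hQα rfl

/-- An order-preserving map in which no value can be raised is the retraction onto its image. -/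
theorem mem_of_orderPreserving
    (hS : ∀ A : Finset ℕ, 1 ∈ A → A ⊆ Finset.Icc 1 n → A.card ≤ r → retract n A n ∈ S)
    (hn : 1 ≤ n) {α : T n} (hα : α ∈ ORD n r)
    (hmono : ∀ i j : X n, (i : ℕ) ≤ j → (α i : ℕ) ≤ α j) : α ∈ S := by
  refine mem_of_unraisable hS (fun α => ∀ i j : X n, (i : ℕ) ≤ j → (α i : ℕ) ≤ α j)
    ?_ ?_ ?_ α hα hmono
  · intro α hd hQ
    left
    rw [orientationPreserving_iff_val hd]
    exact fun i j k hij _ => Or.inl (hQ i j hij.le)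
  · intro α β v _ _ _ hne hβ hQ i j hij
    have h1 := hQ i j hij
    have h2 := hne j
    rw [hβ, hβ]
    split_ifs <;> omega
  · intro α hα hQ hraise
    have hd := hα.1.2
    have h1 := hd.one_mem_im hn
    have hfix : ∀ d : ℕ, ∀ x, (α x : ℕ) + d = n → α (α x) = α x := by
      intro d
      induction d using Nat.strong_induction_on with
      | _ d ih =>
        intro x hx
        -- Otherwise only an attained `xα + 1` blocks raising. By induction that larger value is a
        -- fixed point, and it is at most `x`, contradicting monotonicity.
        have key : ∃ y, (α y : ℕ) = α x ∧ (y : ℕ) ≤ α x := by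
          by_contra! hcon
          obtain ⟨y, hy⟩ := hraise x hcon
          have hyn := val_le (α y)
          have h2 := ih (d - 1) (by omega) y (by omega)
          have h3 := hcon x rfl
          have h4 := hQ (α y) x (by omega)
          rw [h2] at h4
          omega
        obtain ⟨y, hy, hyx⟩ := key
        have h2 := hd.val y
        have h3 : y = α x := Subtype.ext (by omega)
        rw [← h3]
        exact Subtype.ext (by omega)
    have heq : α = retract n (im α) n := by
      apply T.ext_val
      intro x
      symm
      refine retract_eq h1 x (val_le x) (apply_mem_im α x) (hd.val x) fun b hb hbx => ?_
      obtain ⟨y, rfl⟩ := mem_im.1 hb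
      have h2 := hQ (α y) x hbx
      rwa [hfix (n - α y) y (by have := val_le (α y); omega)] at h2
    rw [heq]
    exact hS _ h1 (im_subset_Icc α) (rk_eq_card_im α ▸ hα.2)

/-- Take the first points of the fibres on `[1, m]`, at most `r` of them, and pad to exactly `r`,
the size required in `B n r m`. Retracting moves `x` down no further than the start of its fibre. -/
theorem exists_refining_set {α : T n} {m : ℕ} (hα : α ∈ ORD n r) (hmn : m ≤ n) (hrm : r ≤ m)
    (hm : 1 ≤ m)
    (hmono : ∀ i j : X n, (i : ℕ) ≤ j → (j : ℕ) ≤ m → (α i : ℕ) ≤ α j) :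
    ∃ A : Finset ℕ, 1 ∈ A ∧ A ⊆ Finset.Icc 1 m ∧ A.card = r ∧
      ∀ x : X n, (x : ℕ) ≤ m → α (retract n A m x) = α x := by
  classical
  let A₀ : Finset ℕ := (Finset.univ.filter fun x : X n =>
    (x : ℕ) ≤ m ∧ ∀ y : X n, (y : ℕ) < x → α y ≠ α x).image fun x : X n => x.val
  have hA₀ : ∀ x : X n, (x : ℕ) ≤ m → (∀ y : X n, (y : ℕ) < x → α y ≠ α x) → (x : ℕ) ∈ A₀ :=
    fun x h1 h2 => Finset.mem_image.2 ⟨x, Finset.mem_filter.2 ⟨Finset.mem_univ x, h1, h2⟩, rfl⟩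
  have hsub : A₀ ⊆ Finset.Icc 1 m := by
    intro v hv
    obtain ⟨x, hx, rfl⟩ := Finset.mem_image.1 hv
    exact Finset.mem_Icc.2 ⟨one_le_val x, (Finset.mem_filter.1 hx).2.1⟩
  have hcard : A₀.card ≤ r := by
    refine Finset.card_image_le.trans (le_trans ?_ hα.2)
    rw [rk_eq_card_im]
    refine Finset.card_le_card_of_injOn (fun x => (α x : ℕ)) (fun x _ => apply_mem_im α x) ?_
    intro x hx y hy hxy
    have hx := (Finset.mem_filter.1 hx).2.2
    have hy := (Finset.mem_filter.1 hy).2.2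
    have hxy : α x = α y := Subtype.ext hxy
    apply Subtype.ext
    by_contra hne
    rcases lt_or_gt_of_ne hne with h | h
    · exact hy x h hxy
    · exact hx y h hxy.symm
  obtain ⟨A, hA₀A, hA, hAc⟩ := Finset.exists_subsuperset_card_eq hsub hcard
    (by rw [Nat.card_Icc]; omega)
  have h1 : 1 ∈ A := hA₀A (hA₀ ⟨1, le_rfl, by omega⟩ hm fun y hy => by
    have := one_le_val y
    have hy : (y : ℕ) < 1 := hy
    omega)
  refine ⟨A, h1, hA, hAc, fun x hx => ?_⟩
  have key : ∀ d : ℕ, ∀ y : X n, (y : ℕ) = d → (y : ℕ) ≤ x → α y = α x →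
      ∃ z : X n, (z : ℕ) ∈ A ∧ (z : ℕ) ≤ x ∧ α z = α x := by
    intro d
    induction d using Nat.strong_induction_on with
    | _ d ih =>
      intro y hyd hyx hy
      by_cases hz : ∃ z : X n, (z : ℕ) < y ∧ α z = α y
      · obtain ⟨z, hzy, hz⟩ := hz
        exact ih z (by omega) z rfl (by omega) (hz.trans hy)
      · push Not at hz
        exact ⟨y, hA₀A (hA₀ y (by omega) hz), hyx, hy⟩
  obtain ⟨z, hzA, hzx, hz⟩ := key x x rfl le_rfl rfl
  have h2 := le_retract x hx hzA hzx
  have h3 := retract_decreasing (A := A) (m := m) |>.val x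
  have h4 := hmono _ _ h2 (by omega)
  have h5 := hmono _ _ h3 hx
  rw [hz] at h4
  exact Subtype.ext (by omega)

theorem mem_of_orientationPreserving (hr : 3 ≤ r) (hrn : r ≤ n - 1) (hC : ∀ α ∈ C n r, α ∈ S)
    {α : T n} (hα : α ∈ ORD n r) (ho : OrientationPreserving α) : α ∈ S := by
  have hS : ∀ A : Finset ℕ, 1 ∈ A → A ⊆ Finset.Icc 1 n → A.card ≤ r → retract n A n ∈ S :=
    fun A h1 hA hc => retract_mem_of_C hr hrn hC (r - A.card) A h1 hA (by omega)
  by_cases hmono : ∀ i j : X n, (i : ℕ) ≤ j → (α i : ℕ) ≤ α j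
  · exact mem_of_orderPreserving hS (by omega) hα hmono
  push Not at hmono
  obtain ⟨i, j, hij, hlt⟩ := hmono
  have hd := hα.1.2
  rw [orientationPreserving_iff_val hd] at ho
  have hij : (i : ℕ) < j := by
    refine lt_of_le_of_ne hij fun h => ?_
    rw [Subtype.ext h] at hlt
    omega
  obtain ⟨m, hm1, hmax⟩ := Finset.exists_max_image
    (Finset.univ.filter fun x : X n => (α x : ℕ) ≠ 1) (fun x => (x : ℕ))
    ⟨i, Finset.mem_filter.2 ⟨Finset.mem_univ i, by have := one_le_val (α j); omega⟩⟩
  have hm1 := (Finset.mem_filter.1 hm1).2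
  have htail : ∀ x : X n, (m : ℕ) < x → (α x : ℕ) = 1 := by
    intro x hx
    by_contra h
    have := hmax x (Finset.mem_filter.2 ⟨Finset.mem_univ x, h⟩)
    omega
  have hmono : ∀ i j : X n, (i : ℕ) ≤ j → (j : ℕ) ≤ m → (α i : ℕ) ≤ α j := by
    intro i j hij hjm
    rcases hij.eq_or_lt with h | h
    · rw [Subtype.ext h]
    · exact (ho i j m h hjm).resolve_right hm1
  have hm2 : 2 ≤ (m : ℕ) := by
    by_contra! hlt
    have := one_le_val m
    exact hm1 (hd.val_one _ (by omega))
  have hmn := val_le m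
  have hf : ∀ x : X n, 1 ≤ (if (x : ℕ) ≤ m then (α x : ℕ) else α m) ∧
      (if (x : ℕ) ≤ m then (α x : ℕ) else α m) ≤ x := by
    intro x
    have h1 := hd.val x
    have h2 := hd.val m
    have h3 := one_le_val (α x)
    have h4 := one_le_val (α m)
    split_ifs <;> omega
  -- Replacing the tail of ones by the constant `mα` gives an order-preserving map. A left factor
  -- from `C` restores the tail: `ρ_m` when `m ≤ r`, an element of `B n r m` otherwise.
  let γ : T n := ofFun (fun x => if (x : ℕ) ≤ m then (α x : ℕ) else α m) hf
  have hγval : ∀ x, (γ x : ℕ) = if (x : ℕ) ≤ m then (α x : ℕ) else α m := fun x => rfl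
  have hγd : OrderDecreasing γ := ofFun_decreasing _ hf
  have hγmono : ∀ i j : X n, (i : ℕ) ≤ j → (γ i : ℕ) ≤ γ j := by
    intro i j hij
    rw [hγval, hγval]
    split_ifs with h1 h2
    · exact hmono i j hij h2
    · exact hmono i m h1 le_rfl
    · omega
    · exact le_rfl
  have hγM : γ ∈ ORD n r := by
    refine ⟨⟨Or.inl ?_, hγd⟩, le_trans ?_ hα.2⟩
    · rw [orientationPreserving_iff_val hγd]
      exact fun i j k hij _ => Or.inl (hγmono i j hij.le)
    · rw [rk_eq_card_im, rk_eq_card_im]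
      apply Finset.card_le_card
      intro v hv
      obtain ⟨x, rfl⟩ := mem_im.1 hv
      rw [hγval]
      split_ifs
      · exact apply_mem_im α x
      · exact apply_mem_im α m
  have hγS := mem_of_orderPreserving hS (by omega) hγM hγmono
  by_cases hmr : (m : ℕ) ≤ r
  · have heq : α = rho n m * γ := by
      apply T.ext_val
      intro x
      show (α x : ℕ) = γ (rho n m x)
      have hx := rho_val (m := m) x
      split_ifs at hx with h
      · rw [Subtype.ext hx, hγval, if_pos h]
      · rw [hγd.val_one _ hx, htail x (not_le.1 h)]
    rw [heq]
    exact S.mul_mem (hC _ (Or.inr ⟨m, hm2, hmr, rfl⟩)) hγS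
  · obtain ⟨A, h1, hA, hc, hAα⟩ := exists_refining_set hα hmn (by omega) (by omega) hmono
    have heq : α = retract n A m * γ := by
      apply T.ext_val
      intro x
      show (α x : ℕ) = γ (retract n A m x)
      by_cases h : (x : ℕ) ≤ m
      · have h2 := retract_decreasing (A := A) (m := m) |>.val x
        rw [hγval, if_pos (by omega), hAα x h]
      · rw [hγd.val_one _ (retract_of_lt x (not_le.1 h)), htail x (not_le.1 h)]
    rw [heq]
    exact S.mul_mem (hC _ (retract_mem_C h1 hA hmn (by omega) hc (by omega))) hγS

theorem mem_of_orientationReversing (hr : 3 ≤ r) (hrn : r ≤ n - 1) (hC : ∀ α ∈ C n r, α ∈ S)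
    (hK : ∀ m, 3 ≤ m → m ≤ n - 1 → ∃ κ ∈ K n r m, κ ∈ S)
    {α : T n} (hα : α ∈ ORD n r) (ho : OrientationReversing α) : α ∈ S := by
  have hS : ∀ A : Finset ℕ, 1 ∈ A → A ⊆ Finset.Icc 1 n → A.card ≤ r → retract n A n ∈ S :=
    fun A h1 hA hc => retract_mem_of_C hr hrn hC (r - A.card) A h1 hA (by omega)
  refine mem_of_unraisable hS OrientationReversing (fun α _ h => Or.inr h) ?_ ?_ α hα ho
  · intro α β v hd hβd hv hne hβ hQ
    rw [orientationReversing_iff_val hd] at hQ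
    rw [orientationReversing_iff_val hβd]
    intro i j k hij hjk
    have h1 := hQ i j k hij hjk
    have h2 := hne j
    rw [hβ, hβ, hβ]
    split_ifs <;> omega
  · intro α hα ho hraise
    by_cases hop : OrientationPreserving α
    · exact mem_of_orientationPreserving hr hrn hC hα hop
    have hd := hα.1.2
    have hrev := ho
    rw [orientationReversing_iff_val hd] at hrev
    rw [orientationPreserving_iff_val hd] at hop
    push Not at hop
    obtain ⟨i, j, k, hij, hjk, hlt, hk⟩ := hop
    obtain ⟨z, -, hmax⟩ := Finset.exists_max_image Finset.univ (fun x => (α x : ℕ))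
      ⟨i, Finset.mem_univ i⟩
    have hmax : ∀ x, (α x : ℕ) ≤ α z := fun x => hmax x (Finset.mem_univ x)
    -- Such a point has value below the maximum and precedes `z`, an ascent that orientation
    -- reversal allows only from `1`. Hence intermediate values occur late enough to be raised,
    -- unless the next value is attained.
    have hbelow : ∀ x : X n, (x : ℕ) < α z → (α x : ℕ) = 1 := by
      intro x hx
      have h1 := hd.val x
      have h2 := hd.val z
      rcases hrev x x z le_rfl (by omega) with h | h <;> omega
    have hj : (α j : ℕ) ≠ 1 := by
      intro h
      have h1 := one_le_val (α k)
      rcases hjk.eq_or_lt with h2 | h2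
      · rw [← Subtype.ext h2] at hk
        exact hk h
      · rcases hrev i j k hij.le h2 with h3 | h3 <;> omega
    have h1 := one_le_val (α j)
    have h3 := hmax i
    have hzn : (α z : ℕ) ≤ n - 1 := by
      have h4 := val_le j
      by_contra! hcon
      have := hbelow i (by omega)
      omega
    obtain ⟨κ, hκ, hκS⟩ := hK (α z) (by omega) hzn
    obtain ⟨β, hβ, hβo, heq⟩ := exists_orientationPreserving_mul_eq (by omega) hα ho hκ hmax
      (by
        intro x h2 hlt
        apply hraise
        intro y hy
        by_contra! hcon
        have := hbelow y (by omega)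
        omega)
    rw [heq]
    exact S.mul_mem (mem_of_orientationPreserving hr hrn hC hβ hβo) hκS

end generation

/-! ### The maps `λ_m` and the sets `L_m` -/

section lam

variable {n r m : ℕ}

theorem hat_le_ceilDiv : hat n r ≤ (n + 1) ⌈/⌉ 2 := by
  unfold hat
  split_ifs with h
  · exact h
  · exact le_rfl

theorem hat_cases : (hat n r = r ∧ 2 * r ≤ n + 2) ∨
    (hat n r < r ∧ n + 1 ≤ 2 * hat n r ∧ 2 * hat n r ≤ n + 2) := by
  unfold hat
  rw [Nat.ceilDiv_eq_add_pred_div]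
  split_ifs <;> omega

theorem lam_hat_val (hm : 3 ≤ m) (hmn : m ≤ n - 1) (x : X n) :
    (lam n (hat n r) m x : ℕ) = lamVal n (hat n r) m x :=
  lam_val hat_le_ceilDiv hm hmn x

/-- Passing from `r` to `hat n r` does not change the window within `X n`. When the two differ, `n +
1 ≤ 2 * hat n r` makes the window end at `2m - 2` for `m ≤ n - hat n r + 1`, and at `n` for larger
`m`. -/
theorem lam_mem_K (hr : 3 ≤ r) (hm : 3 ≤ m) (hmn : m ≤ n - 1) :
    lam n (hat n r) m ∈ K n r m := by
  have hh := hat_cases (n := n) (r := r)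
  have hval := lam_hat_val (r := r) hm hmn
  have hcase : ∀ x : X n, ((lam n (hat n r) m x : ℕ) = 1 ∧ (x : ℕ) < m) ∨
      ((lam n (hat n r) m x : ℕ) + x = 2 * m ∧ m ≤ (x : ℕ) ∧ (x : ℕ) + 2 ≤ 2 * m ∧
        (x : ℕ) + 2 ≤ m + r) ∨
      ((lam n (hat n r) m x : ℕ) = 1 ∧ (2 * m < x + 2 ∨ m + r < x + 2)) := by
    intro x
    have h1 := one_le_val x
    have h2 := val_le x
    rw [hval]
    simp only [lamVal]
    split_ifs <;> omega
  have hd : OrderDecreasing (lam n (hat n r) m) := by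
    intro x
    rw [← Subtype.coe_le_coe]
    have := one_le_val x
    rcases hcase x with h | h | h <;> omega
  have ho : OrientationReversing (lam n (hat n r) m) := by
    rw [orientationReversing_iff_val hd]
    intro i j k hij hjk
    rcases hcase i with h1 | h1 | h1 <;> rcases hcase j with h2 | h2 | h2 <;>
      rcases hcase k with h3 | h3 | h3 <;> omega
  refine ⟨⟨⟨Or.inr ho, hd⟩, ?_⟩, ho, ?_⟩
  · rw [rk_eq_card_im]
    have hsub : im (lam n (hat n r) m) ⊆ insert 1 (Finset.Icc (max 2 (m + 2 - r)) m) := by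
      intro v hv
      obtain ⟨x, rfl⟩ := mem_im.1 hv
      rw [Finset.mem_insert, Finset.mem_Icc]
      rcases hcase x with h | h | h <;> omega
    refine (Finset.card_le_card hsub).trans ((Finset.card_insert_le _ _).trans ?_)
    rw [Nat.card_Icc]
    omega
  · intro x h1 h2 h3
    rcases hcase x with h | h | h <;> omega

theorem eq_lam_of_mem_K (hr : 3 ≤ r) (hrn : r ≤ n - 1) (hm : n - hat n r + 2 ≤ m)
    (hmn : m ≤ n - 1) {α : T n} (hα : α ∈ K n r m) : α = lam n (hat n r) m := by
  have hh := hat_cases (n := n) (r := r)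
  have hm3 : 3 ≤ m := by omega
  apply T.ext_val
  intro x
  have hxn := val_le x
  -- For these `m` the window is all of `[m, n]`, so membership in `K` leaves no freedom.
  rw [lam_hat_val hm3 hmn, lamVal, if_neg (by omega)]
  rcases eq_one_or_exists_of_mem_K hm3 hmn hr hα x with h | ⟨y, h1, h2, -, -, -⟩
  · split_ifs with hx
    · exact h
    · have := hα.2.2 x (by omega) (by omega) (by omega)
      omega
  · have := hα.2.2 x (by omega) (by omega) (by omega)
    rw [if_neg (by omega)]
    omega

theorem K_eq_singleton (hr : 3 ≤ r) (hrn : r ≤ n - 1) (hm : n - hat n r + 2 ≤ m)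
    (hmn : m ≤ n - 1) : K n r m = {lam n (hat n r) m} := by
  have hh := hat_cases (n := n) (r := r)
  ext α
  rw [Set.mem_singleton_iff]
  constructor
  · exact eq_lam_of_mem_K hr hrn hm hmn
  · rintro rfl
    exact lam_mem_K hr (by omega) hmn

theorem L_eq_K (hr : 3 ≤ r) (hm : 3 ≤ m) (hmn : m ≤ n - 1) :
    L n (hat n r) m = K n r m := by
  have hlam := lam_mem_K hr hm hmn
  ext α
  constructor
  · rintro ⟨hα, hrange, hleast⟩
    have hval : ∀ x : X n, m ≤ (x : ℕ) → (x : ℕ) + 2 ≤ m + r → (x : ℕ) + 2 ≤ 2 * m →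
        (α x : ℕ) + x = 2 * m := by
      intro x h1 h2 h3
      have hx := hlam.2.2 x h1 h2 h3
      -- Window points are first occurrences of their values, so prescribing least preimages
      -- prescribes the map on the window.
      have h4 : IsLeast (lam n (hat n r) m ⁻¹' {lam n (hat n r) m x}) x := by
        refine ⟨rfl, fun b hb => ?_⟩
        have hb : (lam n (hat n r) m b : ℕ) = lam n (hat n r) m x := congrArg Subtype.val hb
        rw [← Subtype.coe_le_coe]
        rcases eq_one_or_exists_of_mem_K hm hmn hr hlam b with h9 | ⟨z, g1, g2, g3, g4, g5⟩
        · omega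
        · have g6 := hlam.2.2 z g1 g3 g4
          omega
      have h5 : α x = lam n (hat n r) m x := ((hleast _ ⟨x, rfl⟩ x).2 h4).1
      rw [h5]
      exact hx
    refine ⟨⟨hα, ?_⟩, ?_, hval⟩
    · have : rk α = rk (lam n (hat n r) m) := congrArg Set.ncard hrange
      rw [this]
      exact hlam.1.2
    · rcases hα.1 with ho | ho
      · let x : X n := ⟨m, by omega, by omega⟩
        let y : X n := ⟨m + 1, by omega, by omega⟩
        have hx : (x : ℕ) = m := rfl
        have hy : (y : ℕ) = m + 1 := rfl
        have h1 := hval x (by omega) (by omega) (by omega)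
        have h2 := hval y (by omega) (by omega) (by omega)
        exact absurd ho
          (not_orientationPreserving_of_swap hα.2 hm hx hy (by omega) (by omega))
      · exact ho
  · intro hα
    exact ⟨hα.1.1, (range_subset_of_mem_K hm hmn hr hα hlam).antisymm
      (range_subset_of_mem_K hm hmn hr hlam hα), fun _ _ _ =>
      ⟨isLeast_of_mem_K hm hmn hr hα hlam, isLeast_of_mem_K hm hmn hr hlam hα⟩⟩

end lam

/-! ### Maximal subsemigroups -/

section maximal

variable {A : Type*} [Mul A]

/-- The subsemigroup `M \ D`, for a set `D` such that a product in `D` has a factor in `D`. -/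
def diffSubsemigroup (M : Subsemigroup A) (D : Set A)
    (h : ∀ b ∈ M, ∀ c ∈ M, b * c ∈ D → b ∈ D ∨ c ∈ D) : Subsemigroup A where
  carrier := (M : Set A) \ D
  mul_mem' {b c} hb hc :=
    ⟨M.mul_mem hb.1 hc.1, fun hD => (h b hb.1 c hc.1 hD).elim hb.2 hc.2⟩

theorem IsMaximalSubsemigroup.coe_eq_diff {S M : Subsemigroup A}
    (hS : IsMaximalSubsemigroup S M) (D : Set A)
    (h : ∀ b ∈ M, ∀ c ∈ M, b * c ∈ D → b ∈ D ∨ c ∈ D) {a : A} (haM : a ∈ M) (haD : a ∈ D)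
    (hSD : ∀ d ∈ D, d ∉ S) : (S : Set A) = (M : Set A) \ D := by
  have hle : S ≤ diffSubsemigroup M D h := fun s hs => ⟨hS.1.le hs, fun hD => hSD s hD hs⟩
  have hlt : diffSubsemigroup M D h < M :=
    lt_of_le_of_ne (fun s hs => hs.1) fun he => by
      have : a ∈ diffSubsemigroup M D h := by rw [he]; exact haM
      exact this.2 haD
  rw [← hS.2 _ hle hlt]
  rfl

/-- A subsemigroup above `S` containing one element of `D` gets the rest of `D` by left
multiplication by `S`, and is then all of `M`. -/
theorem isMaximalSubsemigroup_of_coe_eq_diff {S M : Subsemigroup A} {D : Set A}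
    (hS : (S : Set A) = (M : Set A) \ D) {a : A} (haM : a ∈ M) (haD : a ∈ D)
    (h : ∀ b ∈ D, ∀ c ∈ D, b ∈ M → c = b ∨ ∃ s ∈ S, c = s * b) : IsMaximalSubsemigroup S M := by
  have hmem : ∀ x, x ∈ S ↔ x ∈ M ∧ x ∉ D := fun x => by
    rw [← SetLike.mem_coe, hS]
    rfl
  refine ⟨lt_of_le_of_ne (fun x hx => ((hmem x).1 hx).1) ?_, fun U hSU hUM => ?_⟩
  · rintro rfl
    exact ((hmem a).1 haM).2 haD
  · refine le_antisymm (fun u hu => (hmem u).2 ⟨hUM.le hu, fun huD => hUM.not_ge fun x hx => ?_⟩) hSU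
    by_cases hxD : x ∈ D
    · rcases h u huD x hxD (hUM.le hu) with rfl | ⟨s, hs, rfl⟩
      · exact hu
      · exact U.mul_mem (hSU hs) hu
    · exact hSU ((hmem x).2 ⟨hx, hxD⟩)

end maximal

/-! ### Generation of `ORD n r` and the classification -/

theorem ORD_le_of_generators {n r : ℕ} (hr : 3 ≤ r) (hrn : r ≤ n - 1) {S : Subsemigroup (T n)}
    (hC : ∀ α ∈ C n r, α ∈ S) (hK : ∀ m, 3 ≤ m → m ≤ n - 1 → ∃ κ ∈ K n r m, κ ∈ S) :
    ORD n r ≤ S := by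
  intro α hα
  rcases hα.1.1 with ho | ho
  · exact mem_of_orientationPreserving hr hrn hC hα ho
  · exact mem_of_orientationReversing hr hrn hC hK hα ho

theorem isMaximalSubsemigroup_of_coe_eq_diff_K {n r m : ℕ} (hr : 3 ≤ r)
    (hm : 3 ≤ m) (hmn : m ≤ n - 1) {S : Subsemigroup (T n)}
    (hS : (S : Set (T n)) = (ORD n r : Set (T n)) \ K n r m) :
    IsMaximalSubsemigroup S (ORD n r) := by
  have hlam := lam_mem_K hr hm hmn
  refine isMaximalSubsemigroup_of_coe_eq_diff hS hlam.1 hlam fun κ hκ α hα _ => Or.inr ?_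
  obtain ⟨β, hβ, hβo, heq⟩ := exists_mul_eq_of_mem_K hm hmn hr hα hκ
  -- The left factor lies outside `K` because it preserves orientation, which no element of `K`
  -- does.
  refine ⟨β, ?_, heq⟩
  rw [← SetLike.mem_coe, hS]
  exact ⟨hβ, fun h => not_orientationPreserving_of_mem_K hr hm hmn h hβo⟩

end OrdTrans

theorem theorem4p4 (n r : ℕ) (hr : 3 ≤ r) (hrn : r ≤ n - 1)
    (S : Subsemigroup (OrdTrans.T n)) (hS : S ≤ OrdTrans.ORD n r) :
    OrdTrans.IsMaximalSubsemigroup S (OrdTrans.ORD n r) ↔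
      (∃ α ∈ OrdTrans.C n r,
        (S : Set (OrdTrans.T n)) = (OrdTrans.ORD n r : Set (OrdTrans.T n)) \ {α}) ∨
      (∃ m, n - OrdTrans.hat n r + 2 ≤ m ∧ m ≤ n - 1 ∧
        (S : Set (OrdTrans.T n)) =
          (OrdTrans.ORD n r : Set (OrdTrans.T n)) \ {OrdTrans.lam n (OrdTrans.hat n r) m}) ∨
      (∃ m, 3 ≤ m ∧ m ≤ n - OrdTrans.hat n r + 1 ∧
        (S : Set (OrdTrans.T n)) =
          (OrdTrans.ORD n r : Set (OrdTrans.T n)) \ OrdTrans.L n (OrdTrans.hat n r) m) := by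
  have hh := OrdTrans.hat_cases (n := n) (r := r)
  constructor
  · intro hmax
    by_cases hC : ∀ α ∈ OrdTrans.C n r, α ∈ S
    · right
      by_cases hK : ∀ m, 3 ≤ m → m ≤ n - 1 → ∃ κ ∈ OrdTrans.K n r m, κ ∈ S
      · exact absurd (OrdTrans.ORD_le_of_generators hr hrn hC hK) hmax.1.not_ge
      · push Not at hK
        obtain ⟨m, hm, hmn, hK⟩ := hK
        have hlam := OrdTrans.lam_mem_K hr hm hmn
        have heq := hmax.coe_eq_diff (OrdTrans.K n r m)
          (fun β hβ γ hγ => OrdTrans.mem_K_of_mul_mem_K hr hm hmn hβ hγ) hlam.1 hlam hK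
        by_cases hmh : m ≤ n - OrdTrans.hat n r + 1
        · exact Or.inr ⟨m, hm, hmh, by rw [OrdTrans.L_eq_K hr hm hmn, heq]⟩
        · exact Or.inl ⟨m, by omega, hmn,
            by rw [← OrdTrans.K_eq_singleton hr hrn (by omega) hmn, heq]⟩
    · left
      push Not at hC
      obtain ⟨α, hα, hαS⟩ := hC
      refine ⟨α, hα, hmax.coe_eq_diff {α} ?_ (OrdTrans.C_subset_ORD hα) rfl ?_⟩
      · intro β hβ γ hγ h
        have h : β * γ = α := h
        subst h
        exact OrdTrans.irreducible_of_mem_C hrn hr hβ hγ hα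
      · rintro _ rfl
        exact hαS
  · rintro (⟨α, hα, h⟩ | ⟨m, hm, hmn, h⟩ | ⟨m, hm, hmn, h⟩)
    · refine OrdTrans.isMaximalSubsemigroup_of_coe_eq_diff h (OrdTrans.C_subset_ORD hα) rfl ?_
      rintro _ rfl _ rfl _
      exact Or.inl rfl
    · rw [← OrdTrans.K_eq_singleton hr hrn hm hmn] at h
      exact OrdTrans.isMaximalSubsemigroup_of_coe_eq_diff_K hr (by omega) hmn h
    · rw [OrdTrans.L_eq_K hr hm (by omega)] at h
      exact OrdTrans.isMaximalSubsemigroup_of_coe_eq_diff_K hr hm (by omega) h
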